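/- For $F\in\mathrm{GL}^+(2)=\{F\in\mathbb{R}^{2\times 2}:\det F>0\}$ let $U=\sqrt{F^TF}$ be the symmetric positive definite square root of $F^TF$, let $\log U$ be its principal (symmetric) matrix logarithm, let $\operatorname{dev}_2X=X-\tfrac12\operatorname{tr}(X)\,\mathbb{1}$ denote the deviatoric part of $X\in\mathbb{R}^{2\times2}$, and let $\|X\|=\bigl(\sum_{i,j}X_{ij}^2\bigr)^{1/2}$ be the Frobenius norm. A function $W:\mathrm{GL}^+(2)\to\mathbb{R}$ is called rank-one convex on $\mathrm{GL}^+(2)$ if $$W\bigl(F+(1-\theta)\,\xi\otimes\eta\bigr)\le\theta\,W(F)+(1-\theta)\,W(F+\xi\otimes\eta)$$ for all $\theta\in[0,1]$, all $F\in\mathrm{GL}^+(2)$ and all $\xi,\eta\in\mathbb{R}^2$ such that $F+t\,\xi\otimes\eta\in\mathrm{GL}^+(2)$ for every $t\in[0,1]$, where $(\xi\otimes\eta)_{ij}=\xi_i\eta_j$. If $k\in\mathbb{R}$ and $k\ge\frac14$, then the function $F\mapsto e^{k\,\|\operatorname{dev}_2\log U\|^2}$ is rank-one convex on $\mathrm{GL}^+(2)$.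 -/

import Mathlib

noncomputable section

namespace Hencky

open Matrix

/-- The Frobenius norm `‖X‖ = √(∑ᵢⱼ Xᵢⱼ²)` of a real square matrix. -/
def frobNorm {n : ℕ} (X : Matrix (Fin n) (Fin n) ℝ) : ℝ :=
  Real.sqrt (∑ i, ∑ j, X i j ^ 2)

/-- The deviatoric part `dev_n X = X - (1/n) tr(X) · 1` of a square matrix. -/
def dev {n : ℕ} (X : Matrix (Fin n) (Fin n) ℝ) : Matrix (Fin n) (Fin n) ℝ :=
  X - ((1 / (n : ℝ)) * X.trace) • (1 : Matrix (Fin n) (Fin n) ℝ)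

open scoped MatrixOrder in
/-- The right stretch tensor `U = √(Fᵀ F)`, the positive semidefinite square root of `Fᵀ F`. -/
def stretch {n : ℕ} (F : Matrix (Fin n) (Fin n) ℝ) : Matrix (Fin n) (Fin n) ℝ :=
  CFC.sqrt (Fᵀ * F)

/-- The principal logarithm of a symmetric positive definite matrix, i.e. the real logarithm
applied to the eigenvalues. -/
def symLog {n : ℕ} (U : Matrix (Fin n) (Fin n) ℝ) : Matrix (Fin n) (Fin n) ℝ :=
  cfc Real.log U

/-- The isochoric exponentiated Hencky energy `F ↦ exp (k ‖dev_n log U‖²)`. -/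
def expHenckyIso {n : ℕ} (k : ℝ) (F : Matrix (Fin n) (Fin n) ℝ) : ℝ :=
  Real.exp (k * frobNorm (dev (symLog (stretch F))) ^ 2)

/-- `GL⁺(n)`, as a subset of the space of real `n × n` matrices. -/
def GLPlus (n : ℕ) : Set (Matrix (Fin n) (Fin n) ℝ) := {F | 0 < F.det}

/-- Rank-one convexity on `GL⁺(n)`: `W` is convex along every closed line segment contained in
`GL⁺(n)` whose end points differ by `ξ ⊗ η`, where `(ξ ⊗ η)ᵢⱼ = ξᵢ ηⱼ`. -/
def RankOneConvexOnGLPlus {n : ℕ} (W : Matrix (Fin n) (Fin n) ℝ → ℝ) : Prop :=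
  ∀ (F : Matrix (Fin n) (Fin n) ℝ) (ξ η : Fin n → ℝ),
    (∀ t ∈ Set.Icc (0 : ℝ) 1, F + t • vecMulVec ξ η ∈ GLPlus n) →
    ∀ θ ∈ Set.Icc (0 : ℝ) 1,
      W (F + (1 - θ) • vecMulVec ξ η) ≤ θ * W F + (1 - θ) * W (F + vecMulVec ξ η)

end Hencky

end

namespace Hencky

open Matrix
open scoped MatrixOrder Matrix.Norms.L2Operator

/-! ### Scalar convexity -/

/-! If `F` has singular values `a ≥ b`, the energy is `exp (k/2 * (log K)²)` with `K = a/b = ‖F‖² /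
det F ≥ 1`, where `‖·‖` is the operator norm (`expHenckyIso_eq`). On a rank-one segment the norm is
convex and the determinant affine, and `a² / d` is jointly convex and increasing in `a ≥ 0`, so `K`
is convex there (`norm_sq_div_det_segment_le`). The outer scalar function is convex for `k ≥ 1/4`
and nondecreasing on `[1, ∞)`, so the composition is convex. -/

/-- `t ↦ exp (k / 2 * (log t)²)` is convex on the positive half-line as soon as `k ≥ 1/4`. -/
theorem convexOn_exp_log_sq {k : ℝ} (hk : 1 / 4 ≤ k) :
    ConvexOn ℝ (Set.Ioi 0) fun t : ℝ => Real.exp (k / 2 * Real.log t ^ 2) := by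
  have hderiv : ∀ x : ℝ, 0 < x →
      HasDerivAt (fun t : ℝ => Real.exp (k / 2 * Real.log t ^ 2))
        (Real.exp (k / 2 * Real.log x ^ 2) * (k * Real.log x / x)) x := by
    intro x hx
    have h := (((Real.hasDerivAt_log hx.ne').pow 2).const_mul (k / 2)).exp
    refine h.congr_deriv ?_
    simp only [Pi.pow_apply]
    push_cast
    ring
  have hderiv' : ∀ x : ℝ, 0 < x →
      HasDerivAt (fun t : ℝ => Real.exp (k / 2 * Real.log t ^ 2) * (k * Real.log t / t))
        (Real.exp (k / 2 * Real.log x ^ 2) * (k / x ^ 2)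
          * (k * Real.log x ^ 2 - Real.log x + 1)) x := by
    intro x hx
    have h := (hderiv x hx).mul
      (((Real.hasDerivAt_log hx.ne').const_mul k).div (hasDerivAt_id x) hx.ne')
    refine h.congr_deriv ?_
    simp only [id, Pi.div_apply]
    field_simp
    ring
  refine convexOn_of_hasDerivWithinAt2_nonneg (convex_Ioi 0)
    (f' := fun x => Real.exp (k / 2 * Real.log x ^ 2) * (k * Real.log x / x))
    (f'' := fun x => Real.exp (k / 2 * Real.log x ^ 2) * (k / x ^ 2)
      * (k * Real.log x ^ 2 - Real.log x + 1))
    (fun x hx => (hderiv x hx).continuousAt.continuousWithinAt) ?_ ?_ ?_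
  · rw [interior_Ioi]
    exact fun x hx => (hderiv x hx).hasDerivWithinAt
  · rw [interior_Ioi]
    exact fun x hx => (hderiv' x hx).hasDerivWithinAt
  · intro x _
    have hk0 : 0 ≤ k := by linarith
    -- The threshold 1/4 enters here: with `L = log x`, the quadratic equals `(k - 1/4) L² + (L/2 -
    -- 1)²`.
    have hquad : 0 ≤ k * Real.log x ^ 2 - Real.log x + 1 := by
      nlinarith [sq_nonneg (Real.log x - 2), sq_nonneg (Real.log x)]
    positivity

theorem monotoneOn_exp_log_sq {k : ℝ} (hk : 0 ≤ k) :
    MonotoneOn (fun t : ℝ => Real.exp (k / 2 * Real.log t ^ 2)) (Set.Ici 1) := by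
  intro x hx y _ hxy
  have hx1 : (1 : ℝ) ≤ x := hx
  have hlog : Real.log x ≤ Real.log y := Real.log_le_log (by linarith) hxy
  have hlog0 : 0 ≤ Real.log x := Real.log_nonneg hx1
  dsimp only
  gcongr

/-- Joint convexity of `(a, d) ↦ a² / d` on the half-plane `d > 0`. -/
theorem sq_div_convex_combination_le {s t c d : ℝ} (a b : ℝ) (hs : 0 ≤ s) (ht : 0 ≤ t)
    (hc : 0 < c) (hd : 0 < d) (hst : 0 < s * c + t * d) :
    (s * a + t * b) ^ 2 / (s * c + t * d) ≤ s * (a ^ 2 / c) + t * (b ^ 2 / d) := by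
  rw [div_le_iff₀ hst]
  -- The convexity defect is an explicit square, as in Lagrange's identity.
  have key : (s * (a ^ 2 / c) + t * (b ^ 2 / d)) * (s * c + t * d) - (s * a + t * b) ^ 2
      = s * t * (a * d - b * c) ^ 2 / (c * d) := by
    field_simp
    ring
  have : 0 ≤ s * t * (a * d - b * c) ^ 2 / (c * d) := by positivity
  linarith

/-! ### The energy as a function of the operator norm and the determinant -/

/-- Traces of `X` and `X * X` become eigenvalue sums under the functional calculus, so `dev` need
not be diagonalised. -/
theorem frobNorm_dev_sq {X : Matrix (Fin 2) (Fin 2) ℝ} (hX : X.IsHermitian) :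
    frobNorm (dev X) ^ 2 = (X * X).trace - X.trace ^ 2 / 2 := by
  have h : X 1 0 = X 0 1 := by simpa using hX.apply 0 1
  rw [frobNorm, Real.sq_sqrt (by positivity)]
  simp [dev, Matrix.trace, Fin.sum_univ_two, Matrix.mul_apply, h]
  ring

theorem trace_cfc {n : ℕ} {A : Matrix (Fin n) (Fin n) ℝ} (hA : A.IsHermitian) (f : ℝ → ℝ) :
    (cfc f A).trace = ∑ i, f (hA.eigenvalues i) := by
  rw [hA.cfc_eq, IsHermitian.cfc, Unitary.conjStarAlgAut_apply, Matrix.trace_mul_comm,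
    ← mul_assoc]
  simp [Matrix.trace]

theorem trace_cfc_mul_self {n : ℕ} {A : Matrix (Fin n) (Fin n) ℝ} (hA : A.IsHermitian)
    (f : ℝ → ℝ) : (cfc f A * cfc f A).trace = ∑ i, f (hA.eigenvalues i) ^ 2 := by
  -- Every function is continuous on a finite spectrum, so `f` is arbitrary.
  have hf : ContinuousOn f (spectrum ℝ A) := A.finite_real_spectrum.continuousOn f
  rw [← cfc_mul f f A hf hf, trace_cfc hA]
  simp only [sq]

/-- Unitary conjugation preserves the operator norm; the right-hand norm is the sup norm. -/
theorem norm_eq_norm_eigenvalues {n : ℕ} {A : Matrix (Fin n) (Fin n) ℝ} (hA : A.IsHermitian) :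
    ‖A‖ = ‖hA.eigenvalues‖ := by
  conv_lhs => rw [hA.spectral_theorem, Unitary.conjStarAlgAut_apply]
  rw [← Unitary.coe_star, CStarRing.norm_mul_coe_unitary, CStarRing.norm_coe_unitary_mul, l2_opNorm_diagonal]
  rfl

section Stretch

variable {n : ℕ} (F : Matrix (Fin n) (Fin n) ℝ)

theorem stretch_posSemidef : (stretch F).PosSemidef :=
  Matrix.nonneg_iff_posSemidef.mp (CFC.sqrt_nonneg _)

theorem stretch_mul_self : stretch F * stretch F = Fᵀ * F :=
  CFC.sqrt_mul_sqrt_self _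
    (Matrix.nonneg_iff_posSemidef.mpr (Matrix.posSemidef_conjTranspose_mul_self F))

/-- By the C⋆-identity, both squared norms equal the norm of `Fᵀ * F`. -/
theorem norm_stretch : ‖stretch F‖ = ‖F‖ := by
  have h : ‖stretch F‖ * ‖stretch F‖ = ‖F‖ * ‖F‖ := by
    rw [← l2_opNorm_conjTranspose_mul_self F, ← l2_opNorm_conjTranspose_mul_self (stretch F),
      (stretch_posSemidef F).isHermitian.eq, stretch_mul_self, conjTranspose_eq_transpose_of_trivial]
  exact (mul_self_inj (norm_nonneg _) (norm_nonneg _)).mp h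

theorem det_stretch (hF : 0 ≤ F.det) : (stretch F).det = F.det := by
  have h : (stretch F).det * (stretch F).det = F.det * F.det := by
    rw [← det_mul, stretch_mul_self, det_mul, det_transpose]
  exact (mul_self_inj (stretch_posSemidef F).det_nonneg hF).mp h

end Stretch

/-- For `F ∈ GL⁺(2)` with singular values `a`, `b`, the operator norm is `max a b`, the determinant
is `a * b`, and `‖dev₂ log U‖²` is `(log a - log b)² / 2`. -/
theorem exists_singularValues {F : Matrix (Fin 2) (Fin 2) ℝ} (hF : 0 < F.det) :
    ∃ a b : ℝ, 0 < a ∧ 0 < b ∧ F.det = a * b ∧ ‖F‖ = max a b ∧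
      frobNorm (dev (symLog (stretch F))) ^ 2 = (Real.log a - Real.log b) ^ 2 / 2 := by
  have hpsd := stretch_posSemidef F
  have hU := hpsd.isHermitian
  have hdet : F.det = hU.eigenvalues 0 * hU.eigenvalues 1 := by
    rw [← det_stretch F hF.le, hU.det_eq_prod_eigenvalues, Fin.prod_univ_two]
    rfl
  have h0 := hpsd.eigenvalues_nonneg 0
  have h1 := hpsd.eigenvalues_nonneg 1
  have hpos : 0 < hU.eigenvalues 0 * hU.eigenvalues 1 := hdet ▸ hF
  refine ⟨hU.eigenvalues 0, hU.eigenvalues 1, pos_of_mul_pos_left hpos h1,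
    pos_of_mul_pos_right hpos h0, hdet, ?_, ?_⟩
  · rw [← norm_stretch, norm_eq_norm_eigenvalues hU]
    refine le_antisymm ?_ (max_le ?_ ?_)
    · refine (pi_norm_le_iff_of_nonneg (le_max_of_le_left h0)).mpr fun i => ?_
      fin_cases i
      · simp [abs_of_nonneg h0]
      · simp [abs_of_nonneg h1]
    · exact (Real.le_norm_self _).trans (norm_le_pi_norm hU.eigenvalues 0)
    · exact (Real.le_norm_self _).trans (norm_le_pi_norm hU.eigenvalues 1)
  · have hL : (cfc Real.log (stretch F)).IsHermitian := cfc_predicate Real.log (stretch F)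
    rw [symLog, frobNorm_dev_sq hL, trace_cfc hU, trace_cfc_mul_self hU, Fin.sum_univ_two,
      Fin.sum_univ_two]
    ring

theorem one_le_norm_sq_div_det {F : Matrix (Fin 2) (Fin 2) ℝ} (hF : 0 < F.det) :
    1 ≤ ‖F‖ ^ 2 / F.det := by
  obtain ⟨a, b, ha, hb, hdet, hnorm, -⟩ := exists_singularValues hF
  rw [one_le_div hF, hdet, hnorm, sq]
  exact mul_le_mul (le_max_left a b) (le_max_right a b) hb.le (le_max_of_le_left ha.le)

theorem expHenckyIso_eq (k : ℝ) {F : Matrix (Fin 2) (Fin 2) ℝ} (hF : 0 < F.det) :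
    expHenckyIso k F = Real.exp (k / 2 * Real.log (‖F‖ ^ 2 / F.det) ^ 2) := by
  obtain ⟨a, b, ha, hb, hdet, hnorm, hdev⟩ := exists_singularValues hF
  have hlog : Real.log (‖F‖ ^ 2 / F.det) ^ 2 = (Real.log a - Real.log b) ^ 2 := by
    rw [hdet, hnorm]
    rcases le_total a b with h | h
    · rw [max_eq_right h, show b ^ 2 / (a * b) = b / a by field_simp,
        Real.log_div hb.ne' ha.ne']
      ring
    · rw [max_eq_left h, show a ^ 2 / (a * b) = a / b by field_simp,
        Real.log_div ha.ne' hb.ne']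
  rw [expHenckyIso, hdev, hlog]
  congr 1
  ring

/-! ### Rank-one segments -/

/-- Since `det (ξ ⊗ η) = 0`, the quadratic term in the segment parameter vanishes. -/
theorem det_add_smul_vecMulVec (F : Matrix (Fin 2) (Fin 2) ℝ) (ξ η : Fin 2 → ℝ) (θ : ℝ) :
    (F + (1 - θ) • vecMulVec ξ η).det = θ * F.det + (1 - θ) * (F + vecMulVec ξ η).det := by
  simp only [det_fin_two, Matrix.add_apply, Matrix.smul_apply, vecMulVec_apply, smul_eq_mul]
  ring

theorem norm_sq_div_det_segment_le {F : Matrix (Fin 2) (Fin 2) ℝ} {ξ η : Fin 2 → ℝ} {θ : ℝ}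
    (hθ : θ ∈ Set.Icc (0 : ℝ) 1) (hF : 0 < F.det) (hG : 0 < (F + vecMulVec ξ η).det)
    (hM : 0 < (F + (1 - θ) • vecMulVec ξ η).det) :
    ‖F + (1 - θ) • vecMulVec ξ η‖ ^ 2 / (F + (1 - θ) • vecMulVec ξ η).det ≤
      θ * (‖F‖ ^ 2 / F.det) +
        (1 - θ) * (‖F + vecMulVec ξ η‖ ^ 2 / (F + vecMulVec ξ η).det) := by
  have h1 : 0 ≤ 1 - θ := by linarith [hθ.2]
  have hnorm : ‖F + (1 - θ) • vecMulVec ξ η‖ ≤ θ * ‖F‖ + (1 - θ) * ‖F + vecMulVec ξ η‖ := by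
    have hcomb : F + (1 - θ) • vecMulVec ξ η = θ • F + (1 - θ) • (F + vecMulVec ξ η) := by
      module
    rw [hcomb]
    refine (norm_add_le _ _).trans_eq ?_
    rw [norm_smul, norm_smul, Real.norm_of_nonneg hθ.1, Real.norm_of_nonneg h1]
  have hdet := det_add_smul_vecMulVec F ξ η θ
  refine le_trans ?_ (sq_div_convex_combination_le _ _ hθ.1 h1 hF hG (hdet ▸ hM))
  rw [← hdet]
  gcongr

end Hencky

open Hencky in
theorem mainTheorem2 (k : ℝ) (hk : 1 / 4 ≤ k) :
    Hencky.RankOneConvexOnGLPlus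
      (fun F : Matrix (Fin 2) (Fin 2) ℝ => Hencky.expHenckyIso k F) := by
  intro F ξ η hseg θ hθ
  have hF : 0 < F.det := by simpa [GLPlus] using hseg 0 (by simp)
  have hG : 0 < (F + Matrix.vecMulVec ξ η).det := by simpa [GLPlus] using hseg 1 (by simp)
  have hM : 0 < (F + (1 - θ) • Matrix.vecMulVec ξ η).det :=
    hseg (1 - θ) ⟨by linarith [hθ.2], by linarith [hθ.1]⟩
  have hle := norm_sq_div_det_segment_le hθ hF hG hM
  have hM1 := one_le_norm_sq_div_det hM
  dsimp only
  rw [expHenckyIso_eq k hF, expHenckyIso_eq k hG, expHenckyIso_eq k hM]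
  -- Monotonicity holds only from 1 on; the convex combination also exceeds 1 because it bounds the
  -- middle value from above.
  refine (monotoneOn_exp_log_sq (by linarith) hM1 (hM1.trans hle) hle).trans ?_
  exact (convexOn_exp_log_sq hk).2 (zero_lt_one.trans_le (one_le_norm_sq_div_det hF))
    (zero_lt_one.trans_le (one_le_norm_sq_div_det hG)) hθ.1 (by linarith [hθ.2]) (by ring)
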